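/- Let $G$ be a finite 3-edge-connected graph (multiple edges and loops are allowed; $G$ is nonempty and remains connected after deleting any at most two edges) with a chosen orientation of its edges. Let $\mathcal F(G)\subset\mathbb Z^{E(G)}\subset\mathbb R^{E(G)}$ be its lattice of integer flows (integer vectors for which, at every vertex, the sum over the incoming edges equals the sum over the outgoing edges), with the Euclidean inner product $(\cdot,\cdot)$. Let $V$ be its Voronoi cell, that is, the polytope of all points of the real span of $\mathcal F(G)$ that are at least as close to the origin as to any other point of $\mathcal F(G)$. Faces of $V$ are nonempty, $V$ itself is a face, and two faces of the same dimension are parallel if their affine hulls have the same direction. A circuit is the edge set of a closed walk that repeats no vertex and no edge. Each of the two oriented circuits with edge set $C$ gives a vector $c\in\mathcal F(G)$ (equal to $1$ or $-1$ on the edges of $C$ that are traversed along or against their orientation, and $0$ elsewhere), and we put $F_c=\{x\in V:(x,c)=(c,c)/2\}$. For an edge $e$ and a strong orientation $\sigma$ of $G-e$ (every vertex can be reached from every other one by a directed path), let $F_{G-e,\sigma}$ be the set of the points of $V$ that lie in $F_c$ for every oriented circuit $c$ in $G-e$ directed according to $\sigma$. Then: 1. There is a bijection between $E(G)$ and the parallel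 classes of edges (1-dimensional faces) of $V$; the class corresponding to $e$ is $\{F_{G-e,\sigma}:\sigma\text{ a strong orientation of }G-e\}$. 2. There is a bijection between the circuits of $G$ and the parallel classes of facets (codimension one faces) of $V$; the class corresponding to $C$ consists of the faces $F_c$ and $F_{-c}=-F_c$ given by the two orientations of $C$. 3. An edge $e\in E(G)$ belongs to a circuit $C$ if and only if no member of the parallel class of edges of $V$ corresponding to $e$ is contained in the facet $F_c$, for either of the two orientations $c$ of $C$. -/

import Mathlib

open scoped Graph

/-! ### Faces of polytopes and their parallel classes -/

section Polytopes

variable {E : Type*} [NormedAddCommGroup E] [InnerProductSpace ℝ E]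

/-- The dimension of (the affine hull of) a nonempty set. -/
noncomputable def affDim (F : Set E) : ℕ := Module.finrank ℝ (vectorSpan ℝ F)

/-- `F` is a nonempty face of the polytope `P`: the set of maximizers over `P` of a linear
functional. The polytope itself is a face (take the zero functional). -/
def IsFaceOfPolytope (P F : Set E) : Prop := F.Nonempty ∧ IsExposed ℝ P F

/-- The edges (faces of dimension one) of a polytope. -/
def polytopeEdges (P : Set E) : Set (Set E) := {F | IsFaceOfPolytope P F ∧ affDim F = 1}

/-- The facets (faces of codimension one) of a polytope. -/
def polytopeFacets (P : Set E) : Set (Set E) := {F | IsFaceOfPolytope P F ∧ affDim F + 1 = affDim P}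

/-- Two faces are parallel when their affine hulls have the same direction.
`parallelClasses 𝓕` is the set of the parallel classes of a family `𝓕` of faces. -/
def parallelClasses (𝓕 : Set (Set E)) : Set (Set (Set E)) :=
  {K | ∃ F ∈ 𝓕, K = {F' ∈ 𝓕 | vectorSpan ℝ F' = vectorSpan ℝ F}}

/-- The (closed) Voronoi cell of a lattice `L`: the points of the real span of `L` that are
at least as close to the origin as to any other point of `L`. -/
def voronoiCell (L : Submodule ℤ E) : Set E :=
  {x | x ∈ Submodule.span ℝ (L : Set E) ∧ ∀ y ∈ L, ‖x‖ ≤ ‖x - y‖}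

end Polytopes

/-! ### Graphs with multiple edges and loops -/

namespace Graph

variable {α β : Type*}

/-- A graph is connected if it has a vertex and any two vertices are joined by a walk. -/
def IsConnected (G : Graph α β) : Prop :=
  V(G).Nonempty ∧ ∀ u ∈ V(G), ∀ v ∈ V(G), Relation.ReflTransGen G.Adj u v

/-- A graph is 3-edge-connected if it remains connected after deleting any at most two edges. -/
def IsThreeEdgeConnected (G : Graph α β) : Prop :=
  ∀ S : Set β, S.encard ≤ 2 → (G.deleteEdges S).IsConnected

/-- The data of a closed walk `v 0, e 0, v 1, e 1, …, v k, e k, v 0` which does not go through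
the same edge or vertex twice (addition in `Fin (k + 1)` is cyclic). -/
def IsCircuitWalk (G : Graph α β) {k : ℕ} (v : Fin (k + 1) → α) (e : Fin (k + 1) → E(G)) : Prop :=
  Function.Injective v ∧ Function.Injective e ∧ ∀ i, G.IsLink (e i) (v i) (v (i + 1))

/-- A set of edges is a circuit if it is the set of edges of a closed walk without repetitions. -/
def IsCircuit (G : Graph α β) (C : Set E(G)) : Prop :=
  ∃ (k : ℕ) (v : Fin (k + 1) → α) (e : Fin (k + 1) → E(G)), G.IsCircuitWalk v e ∧ Set.range e = C

/-- A choice of a direction, from `tail` to `head`, for each edge. -/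
structure EdgeOrientation (G : Graph α β) where
  /-- the vertex where the edge begins -/
  tail : E(G) → α
  /-- the vertex where the edge ends -/
  head : E(G) → α
  isLink : ∀ e : E(G), G.IsLink e (tail e) (head e)

namespace EdgeOrientation

variable {G : Graph α β} [Fintype E(G)]

open Classical in
/-- The lattice of integer flows, inside the Euclidean space on the set of edges: integer vectors
for which, at every vertex, the sum over the incoming edges equals the sum over the outgoing
edges. -/
def flowLattice (o : G.EdgeOrientation) : Submodule ℤ (EuclideanSpace ℝ E(G)) where
  carrier := {a | (∀ e, ∃ n : ℤ, a e = n) ∧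
    ∀ v ∈ V(G), ∑ e with o.head e = v, a e = ∑ e with o.tail e = v, a e}
  zero_mem' := ⟨fun _ => ⟨0, by simp⟩, by simp⟩
  add_mem' := by
    rintro a b ⟨ha, ha'⟩ ⟨hb, hb'⟩
    refine ⟨fun e => ?_, fun v hv => ?_⟩
    · obtain ⟨m, hm⟩ := ha e
      obtain ⟨n, hn⟩ := hb e
      exact ⟨m + n, by simp [hm, hn]⟩
    · simp [Finset.sum_add_distrib, ha' v hv, hb' v hv]
  smul_mem' := by
    rintro c a ⟨ha, ha'⟩
    refine ⟨fun e => ?_, fun v hv => ?_⟩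
    · obtain ⟨m, hm⟩ := ha e
      exact ⟨c * m, by simp [hm]⟩
    · have := congrArg (fun t : ℝ => (c : ℝ) * t) (ha' v hv)
      simpa [Finset.mul_sum] using this

/-- The Voronoi cell of the lattice of integer flows. -/
def flowVoronoiCell (o : G.EdgeOrientation) : Set (EuclideanSpace ℝ E(G)) :=
  voronoiCell o.flowLattice

/-- `c` is the circuit element of an oriented circuit with edge set `C`: the circuit is traversed
by a closed walk without repetitions, `c` is `1` on the edges traversed from tail to head, `-1` on
the edges traversed from head to tail, and `0` off the circuit. (A loop can be traversed in
either direction.) -/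
def IsCircuitElement (o : G.EdgeOrientation) (C : Set E(G)) (c : EuclideanSpace ℝ E(G)) : Prop :=
  ∃ (k : ℕ) (v : Fin (k + 1) → α) (e : Fin (k + 1) → E(G)),
    G.IsCircuitWalk v e ∧ Set.range e = C ∧ (∀ f ∉ C, c f = 0) ∧
    ∀ i, (c (e i) = 1 ∧ o.tail (e i) = v i ∧ o.head (e i) = v (i + 1)) ∨
      (c (e i) = -1 ∧ o.tail (e i) = v (i + 1) ∧ o.head (e i) = v i)

/-- The part `F_c` of the Voronoi cell on the perpendicular bisector of `0` and `c`. -/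
def bisectorFace (o : G.EdgeOrientation) (c : EuclideanSpace ℝ E(G)) :
    Set (EuclideanSpace ℝ E(G)) :=
  {x ∈ o.flowVoronoiCell | inner ℝ x c = inner ℝ c c / 2}

/-- `u` and `v` are joined by an edge that lies in `H`. -/
def StepIn (_o : G.EdgeOrientation) (H : Set E(G)) (u v : α) : Prop :=
  ∃ f ∈ H, G.IsLink f u v

/-- There is an edge in `H` that is directed from `u` to `v` in the orientation `σ`. Here an
orientation is described by its signs with respect to the reference orientation `o`: the sign
is `1` where the directions agree and `-1` where they are opposite. -/
def DirectedStepIn (o : G.EdgeOrientation) (H : Set E(G)) (σ : E(G) → ℤˣ) (u v : α) : Prop :=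
  ∃ f ∈ H, (σ f = 1 ∧ o.tail f = u ∧ o.head f = v) ∨ (σ f = -1 ∧ o.tail f = v ∧ o.head f = u)

/-- `σ` restricts to a strong orientation of the spanning subgraph with edge set `H`: in each
connected component of the subgraph there is a directed path from any vertex to any other one. -/
def IsStrongOn (o : G.EdgeOrientation) (H : Set E(G)) (σ : E(G) → ℤˣ) : Prop :=
  ∀ u ∈ V(G), ∀ v ∈ V(G), Relation.ReflTransGen (o.StepIn H) u v →
    Relation.ReflTransGen (o.DirectedStepIn H σ) u v

/-- The face `F_{H,σ}` of the Voronoi cell given by a spanning subgraph with edge set `H` and an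
orientation `σ`: the intersection (within the Voronoi cell) of the `F_c` over all oriented
circuits `c` in `H` that are directed by `σ`. -/
def orientedSubgraphFace (o : G.EdgeOrientation) (H : Set E(G)) (σ : E(G) → ℤˣ) :
    Set (EuclideanSpace ℝ E(G)) :=
  {x ∈ o.flowVoronoiCell | ∀ C c, o.IsCircuitElement C c → C ⊆ H →
    (∀ f ∈ C, c f = ((σ f : ℤ) : ℝ)) → x ∈ o.bisectorFace c}

end EdgeOrientation

end Graph

namespace Graph.EdgeOrientation

variable {α β : Type*} {G : Graph α β}

/-! On real flows, the support function of the Voronoi cell is half the `ℓ¹` norm. For the upper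
bound, a flow is a nonnegative combination of circuit elements agreeing with it in sign
(`mem_span_conformalCircuits`); the `ℓ¹` norm is additive on such combinations, and a circuit
element satisfies `(c, c) = ‖c‖₁`. For attainment, `|n| ≤ n²` on integers puts the projection of the
cube `[-1/2, 1/2]^E` inside the cell, and half the sign vector of `f` projects to a maximizer.

So every face is a `supportFace f`, and its direction is the orthogonal complement, within the
flows, of the flows supported on the support of `f` (`vectorSpan_supportFace`). A facet requires
these to form a line, which makes `f` a positive multiple of a circuit element. An edge requires
them to form a hyperplane: by 3-edge-connectedness the projected basis vectors `edgeProj e` are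
nonzero and pairwise non-parallel, so `f` vanishes on exactly one edge `e` and the direction is
spanned by `edgeProj e`. Sign patterns of such `f` are the strong orientations of `G - e`. Incidence
follows from `(edgeProj e, c) = c e`. -/

theorem IsCircuitElement.eq_one_or_neg_one {o : G.EdgeOrientation} {C : Set E(G)}
    {c : EuclideanSpace ℝ E(G)} (h : o.IsCircuitElement C c) {e : E(G)} (he : e ∈ C) :
    c e = 1 ∨ c e = -1 := by
  obtain ⟨k, v, w, -, rfl, -, h⟩ := h
  obtain ⟨i, rfl⟩ := he
  exact (h i).imp And.left And.left

theorem IsCircuitElement.eq_zero {o : G.EdgeOrientation} {C : Set E(G)}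
    {c : EuclideanSpace ℝ E(G)} (h : o.IsCircuitElement C c) {e : E(G)} (he : e ∉ C) :
    c e = 0 := by
  obtain ⟨k, v, w, -, -, h, -⟩ := h
  exact h e he

theorem IsCircuitElement.nonempty {o : G.EdgeOrientation} {C : Set E(G)}
    {c : EuclideanSpace ℝ E(G)} (h : o.IsCircuitElement C c) : C.Nonempty := by
  obtain ⟨k, v, w, -, rfl, -⟩ := h
  exact ⟨w 0, 0, rfl⟩

theorem IsCircuitElement.isCircuit {o : G.EdgeOrientation} {C : Set E(G)}
    {c : EuclideanSpace ℝ E(G)} (h : o.IsCircuitElement C c) : G.IsCircuit C := by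
  obtain ⟨k, v, w, h, h', -⟩ := h
  exact ⟨k, v, w, h, h'⟩

theorem IsCircuitElement.ne_zero_iff {o : G.EdgeOrientation} {C : Set E(G)}
    {c : EuclideanSpace ℝ E(G)} (h : o.IsCircuitElement C c) {e : E(G)} :
    c e ≠ 0 ↔ e ∈ C := by
  refine ⟨fun h' => by_contra fun he => h' (h.eq_zero he), fun he => ?_⟩
  rcases h.eq_one_or_neg_one he with h | h <;> simp [h]

theorem IsCircuitElement.sq_eq_abs {o : G.EdgeOrientation} {C : Set E(G)}
    {c : EuclideanSpace ℝ E(G)} (h : o.IsCircuitElement C c) (e : E(G)) :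
    c e * c e = |c e| := by
  by_cases he : e ∈ C
  · rcases h.eq_one_or_neg_one he with h | h <;> simp [h]
  · simp [h.eq_zero he]

variable [Fintype E(G)]

/-! ### Real flows and circuit elements -/

theorem inner_eq_sum {ι : Type*} [Fintype ι] (x y : EuclideanSpace ℝ ι) :
    inner ℝ x y = ∑ i, x i * y i := by
  simp [PiLp.inner_apply, mul_comm]

/-- The space of real flows. Conservation is expressed by testing against potentials. -/
def realFlows (o : G.EdgeOrientation) : Submodule ℝ (EuclideanSpace ℝ E(G)) where
  carrier := {f | ∀ φ : α → ℝ, ∑ e, f e * (φ (o.head e) - φ (o.tail e)) = 0}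
  zero_mem' := by simp
  add_mem' := by
    intro a b ha hb φ
    simp [add_mul, Finset.sum_add_distrib, ha φ, hb φ]
  smul_mem' := by
    intro c a ha φ
    simp [mul_assoc, ← Finset.mul_sum, ha φ]

theorem mem_realFlows {o : G.EdgeOrientation} {f : EuclideanSpace ℝ E(G)} :
    f ∈ o.realFlows ↔ ∀ φ : α → ℝ, ∑ e, f e * (φ (o.head e) - φ (o.tail e)) = 0 := Iff.rfl

theorem mem_flowLattice_iff {o : G.EdgeOrientation} {f : EuclideanSpace ℝ E(G)} :
    f ∈ o.flowLattice ↔ (∀ e, ∃ n : ℤ, f e = n) ∧ f ∈ o.realFlows := by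
  classical
  refine and_congr_right fun _ => ?_
  rw [mem_realFlows]
  constructor
  · intro h φ
    -- The vertex type may be infinite, so terms are regrouped over the finite set of end vertices.
    let T : Finset α := Finset.univ.image o.head ∪ Finset.univ.image o.tail
    have key (t : E(G) → α) (ht : ∀ e, t e ∈ T) :
        ∑ e, f e * φ (t e) = ∑ v ∈ T, (∑ e with t e = v, f e) * φ v := by
      rw [← Finset.sum_fiberwise_of_maps_to (s := Finset.univ) (t := T) (g := t)
        (fun e _ => ht e)]
      refine Finset.sum_congr rfl fun v _ => ?_
      rw [Finset.sum_mul]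
      refine Finset.sum_congr rfl fun e he => ?_
      rw [(Finset.mem_filter.1 he).2]
    have hT : ∀ v ∈ T, v ∈ V(G) := by
      intro v hv
      rcases Finset.mem_union.1 hv with hv | hv
      · obtain ⟨e, -, rfl⟩ := Finset.mem_image.1 hv
        exact (o.isLink e).right_mem
      · obtain ⟨e, -, rfl⟩ := Finset.mem_image.1 hv
        exact (o.isLink e).left_mem
    simp only [mul_sub, Finset.sum_sub_distrib]
    rw [key o.head (by simp [T]), key o.tail (by simp [T]), sub_eq_zero]
    refine Finset.sum_congr rfl fun v hv => ?_
    congr 1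
    convert h v (hT v hv)
  · intro h v _
    have := h (fun u => if u = v then 1 else 0)
    simp only [mul_sub, Finset.sum_sub_distrib, mul_ite, mul_one, mul_zero, sub_eq_zero] at this
    rw [← Finset.sum_filter, ← Finset.sum_filter] at this
    convert this

omit [Fintype E(G)] in
theorem IsCircuitElement.ne_zero {o : G.EdgeOrientation} {C : Set E(G)}
    {c : EuclideanSpace ℝ E(G)} (h : o.IsCircuitElement C c) : c ≠ 0 := by
  rintro rfl
  obtain ⟨e, he⟩ := h.nonempty
  exact h.ne_zero_iff.2 he rfl

/-- Summation of a coboundary along an oriented circuit. -/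
theorem sum_mul_coboundary {o : G.EdgeOrientation} {k : ℕ} {v : Fin (k + 1) → α}
    {w : Fin (k + 1) → E(G)} {c g : EuclideanSpace ℝ E(G)} (hw : Function.Injective w)
    (hc : ∀ i, (c (w i) = 1 ∧ o.tail (w i) = v i ∧ o.head (w i) = v (i + 1)) ∨
      (c (w i) = -1 ∧ o.tail (w i) = v (i + 1) ∧ o.head (w i) = v i))
    (hg : ∀ f ∉ Set.range w, g f = 0) (φ : α → ℝ) :
    ∑ e, g e * (φ (o.head e) - φ (o.tail e)) =
      ∑ i, g (w i) * c (w i) * (φ (v (i + 1)) - φ (v i)) := by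
  symm
  refine Fintype.sum_of_injective w hw _ _ (fun f hf => by simp [hg f hf]) fun i => ?_
  rcases hc i with ⟨h1, h2, h3⟩ | ⟨h1, h2, h3⟩
  · rw [h1, h2, h3]; ring
  · rw [h1, h2, h3]; ring

theorem IsCircuitElement.mem_realFlows {o : G.EdgeOrientation} {C : Set E(G)}
    {c : EuclideanSpace ℝ E(G)} (h : o.IsCircuitElement C c) : c ∈ o.realFlows := by
  have hone := fun e => h.eq_one_or_neg_one (e := e)
  obtain ⟨k, v, w, ⟨-, hw, -⟩, rfl, h0, hc⟩ := h
  intro φ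
  rw [sum_mul_coboundary hw hc h0]
  have hsq' (i : Fin (k + 1)) : c (w i) * c (w i) = 1 := by
    rcases hone _ ⟨i, rfl⟩ with h | h <;> simp [h]
  simp only [hsq', one_mul, Finset.sum_sub_distrib]
  rw [sub_eq_zero]
  -- The cyclic shift permutes the vertices of the circuit, so the sum telescopes to zero.
  exact Equiv.sum_comp (Equiv.addRight (1 : Fin (k + 1))) (fun i => φ (v i))

theorem IsCircuitElement.mem_flowLattice {o : G.EdgeOrientation} {C : Set E(G)}
    {c : EuclideanSpace ℝ E(G)} (h : o.IsCircuitElement C c) : c ∈ o.flowLattice := by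
  refine mem_flowLattice_iff.2 ⟨fun e => ?_, h.mem_realFlows⟩
  by_cases he : e ∈ C
  · rcases h.eq_one_or_neg_one he with h | h
    · exact ⟨1, by simp [h]⟩
    · exact ⟨-1, by simp [h]⟩
  · exact ⟨0, by simp [h.eq_zero he]⟩

/-- The flows supported on a circuit are the multiples of its circuit element. -/
theorem IsCircuitElement.eq_smul {o : G.EdgeOrientation} {C : Set E(G)}
    {c : EuclideanSpace ℝ E(G)} (h : o.IsCircuitElement C c) {g : EuclideanSpace ℝ E(G)}
    (hg : g ∈ o.realFlows) (hgC : ∀ e ∉ C, g e = 0) : ∃ r : ℝ, g = r • c := by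
  classical
  have hone := fun e => h.eq_one_or_neg_one (e := e)
  obtain ⟨k, v, w, ⟨hv, hw, -⟩, rfl, h0, hc⟩ := h
  -- Conservation at `v (i + 1)`, where only `w i` and `w (i + 1)` contribute.
  have step (i : Fin (k + 1)) :
      g (w (i + 1)) * c (w (i + 1)) = g (w i) * c (w i) := by
    let φ : α → ℝ := fun u => if u = v (i + 1) then 1 else 0
    have := (sum_mul_coboundary hw hc hgC φ).symm.trans (hg φ)
    simp only [φ, hv.eq_iff, mul_sub, Finset.sum_sub_distrib, add_left_inj] at this
    simp at this
    linarith
  have const (i : Fin (k + 1)) : g (w i) * c (w i) = g (w 0) * c (w 0) := by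
    induction i using Fin.induction with
    | zero => rfl
    | succ i ih => rw [← ih, ← step i.castSucc, Fin.coeSucc_eq_succ]
  refine ⟨g (w 0) * c (w 0), ?_⟩
  ext e
  by_cases he : e ∈ Set.range w
  · obtain ⟨i, rfl⟩ := he
    have := const i
    simp only [PiLp.smul_apply, smul_eq_mul, ← this]
    rcases hone _ ⟨i, rfl⟩ with h | h <;> simp [h]
  · simp [hgC e he, h0 e he]

/-! ### Conformal decomposition into circuits -/

/-- A nonzero flow contains a circuit directed along the flow. -/
theorem exists_conformal_circuit {o : G.EdgeOrientation} {f : EuclideanSpace ℝ E(G)}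
    (hf : f ∈ o.realFlows) (hf0 : f ≠ 0) :
    ∃ C c, o.IsCircuitElement C c ∧ ∀ e ∈ C, 0 < c e * f e := by
  classical
  let dt : E(G) → α := fun e => if 0 < f e then o.tail e else o.head e
  let dh : E(G) → α := fun e => if 0 < f e then o.head e else o.tail e
  -- If no edge carried flow out of `dh e`, conservation there would be a vanishing sum of
  -- nonnegative terms, with a positive one from `e`.
  have next (e : {e // f e ≠ 0}) : ∃ e' : {e // f e ≠ 0}, dt e' = dh e := by
    by_contra! hne
    have hsum := hf (fun u => if u = dh e then 1 else 0)
    have hterm (a : E(G)) : f a * ((if o.head a = dh e then 1 else 0) -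
        (if o.tail a = dh e then 1 else 0)) =
        |f a| * ((if dh a = dh e then 1 else 0) - (if dt a = dh e then 1 else 0)) := by
      by_cases h : 0 < f a
      · simp [dt, dh, h, abs_of_pos h]
      · simp only [dt, dh, h, if_false, abs_of_nonpos (not_lt.1 h)]; ring
    have hnn (a : E(G)) : 0 ≤ |f a| * ((if dh a = dh e then (1 : ℝ) else 0) -
        (if dt a = dh e then 1 else 0)) := by
      by_cases h : f a = 0
      · simp [h]
      · rw [if_neg (hne ⟨a, h⟩)]
        split_ifs <;> simp
    rw [Finset.sum_congr rfl fun a _ => hterm a,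
      Finset.sum_eq_zero_iff_of_nonneg fun a _ => hnn a] at hsum
    have := hsum e (Finset.mem_univ _)
    rw [if_neg (hne e)] at this
    simp [e.2] at this
  choose nx hnx using next
  obtain ⟨e₀, he₀⟩ : ∃ e, f e ≠ 0 := by
    by_contra! h
    exact hf0 (by ext e; simp [h e])
  let s : ℕ → {e // f e ≠ 0} := fun n => nx^[n] ⟨e₀, he₀⟩
  have hs (n : ℕ) : dt (s (n + 1)) = dh (s n) := by
    simp only [s, Function.iterate_succ_apply']
    exact hnx _
  -- A return with the smallest gap `d + 1` bounds a closed walk without repeated vertices.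
  have hex : ∃ d, ∃ i, dt (s i) = dt (s (i + (d + 1))) := by
    obtain ⟨i, j, hij, h⟩ := Finite.exists_ne_map_eq_of_infinite s
    wlog hlt : i < j generalizing i j
    · exact this j i hij.symm h.symm (by omega)
    exact ⟨j - i - 1, i, by rw [h]; congr 3; omega⟩
  obtain ⟨i, hi⟩ := Nat.find_spec hex
  set k := Nat.find hex with hk
  have hmin (a b : ℕ) (hab : a < b) (hb : b ≤ k) : dt (s (i + a)) ≠ dt (s (i + b)) := by
    intro h
    refine Nat.find_min hex (m := b - a - 1) (by omega) ⟨i + a, ?_⟩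
    rw [h]; congr 3; omega
  let v : Fin (k + 1) → α := fun m => dt (s (i + m))
  let w : Fin (k + 1) → E(G) := fun m => (s (i + m) : E(G))
  have hv : Function.Injective v := by
    intro a b hab
    by_contra hne
    rcases lt_or_gt_of_ne hne with h | h
    · exact hmin a b h (by omega) hab
    · exact hmin b a h (by omega) hab.symm
  have hw : Function.Injective w := fun a b hab => hv (congrArg dt hab)
  have hdh (m : Fin (k + 1)) : dh (w m) = v (m + 1) := by
    have h1 : dh (w m) = dt (s (i + (m + 1))) := (hs (i + m)).symm
    rw [h1]
    rcases Fin.eq_castSucc_or_eq_last m with ⟨m, rfl⟩ | rfl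
    · simp [v, Fin.coeSucc_eq_succ]
    · simp [v, ← hi]
  refine ⟨Set.range w,
    WithLp.toLp 2 fun e => if e ∈ Set.range w then (if 0 < f e then 1 else -1) else 0,
    ⟨k, v, w, ⟨hv, hw, fun m => ?_⟩, rfl, fun e he => by simp [he], fun m => ?_⟩, ?_⟩
  · rw [← hdh m]
    by_cases h : 0 < f (w m)
    · simpa [v, dt, dh, h, w] using o.isLink (w m)
    · simpa [v, dt, dh, h, w] using (o.isLink (w m)).symm
  · rw [← hdh m]
    have : v m = dt (w m) := rfl
    rw [this]
    by_cases h : 0 < f (w m)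
    · left; simp [dt, dh, h]
    · right; simp [dt, dh, h]
  · rintro e ⟨m, rfl⟩
    have hne : f (w m) ≠ 0 := (s (i + m)).2
    by_cases h : 0 < f (w m)
    · simp [h]
    · have : f (w m) < 0 := lt_of_le_of_ne (not_lt.1 h) hne
      simp [h, this]

/-- The circuit elements that agree in sign with `f`. -/
def conformalCircuits (o : G.EdgeOrientation) (f : EuclideanSpace ℝ E(G)) :
    Set (EuclideanSpace ℝ E(G)) :=
  {c | ∃ C, o.IsCircuitElement C c ∧ ∀ e ∈ C, 0 < c e * f e}

-- Subtract a conformal circuit, scaled by the least `|f m|` on it: the coordinate `m` dies and no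
-- sign is reversed or created, so induction on the size of the support applies.
open scoped NNReal in
theorem mem_span_conformalCircuits {o : G.EdgeOrientation} {f : EuclideanSpace ℝ E(G)}
    (hf : f ∈ o.realFlows) : f ∈ Submodule.span ℝ≥0 (o.conformalCircuits f) := by
  classical
  induction hn : (Finset.univ.filter fun e => f e ≠ 0).card using Nat.strong_induction_on
    generalizing f with
  | _ n ih =>
  by_cases hf0 : f = 0
  · rw [hf0]; exact Submodule.zero_mem _
  obtain ⟨C, c, hc, hpos⟩ := exists_conformal_circuit hf hf0
  obtain ⟨m, hmC, hm⟩ := Set.exists_min_image C (fun e => |f e|) (Set.toFinite C) hc.nonempty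
  set r : ℝ≥0 := ⟨|f m|, abs_nonneg _⟩ with hr
  let f' := f - r • c
  have hf'e (e : E(G)) : f' e = f e - |f m| * c e := by
    simp only [f', NNReal.smul_def, PiLp.sub_apply, PiLp.smul_apply, smul_eq_mul]
    rfl
  have hf' : f' ∈ o.realFlows := by
    have : f' = f - (|f m|) • c := by ext e; simp [hf'e]
    rw [this]
    exact Submodule.sub_mem _ hf (Submodule.smul_mem _ _ hc.mem_realFlows)
  have hsupp (e : E(G)) (h : 0 < f' e) : 0 < f e := by
    rw [hf'e] at h
    by_cases he : e ∈ C
    · have h1 := hpos e he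
      have h2 := hm e he
      rcases hc.eq_one_or_neg_one he with h3 | h3 <;> rw [h3] at h h1
      · linarith
      · have : f e < 0 := by linarith
        rw [abs_of_neg this] at h2; linarith
    · rw [hc.eq_zero he] at h; linarith
  have hsupp' (e : E(G)) (h : f' e < 0) : f e < 0 := by
    rw [hf'e] at h
    by_cases he : e ∈ C
    · have h1 := hpos e he
      have h2 := hm e he
      rcases hc.eq_one_or_neg_one he with h3 | h3 <;> rw [h3] at h h1
      · have : 0 < f e := by linarith
        rw [abs_of_pos this] at h2; linarith
      · linarith
    · rw [hc.eq_zero he] at h; linarith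
  have hm0 : f' m = 0 := by
    rw [hf'e]
    have := hpos m hmC
    rcases hc.eq_one_or_neg_one hmC with h3 | h3 <;> rw [h3] at this ⊢
    · rw [abs_of_pos (by linarith)]; ring
    · rw [abs_of_neg (by linarith)]; ring
  have hlt : (Finset.univ.filter fun e => f' e ≠ 0).card < n := by
    rw [← hn]
    refine Finset.card_lt_card ?_
    rw [Finset.ssubset_iff_of_subset]
    · refine ⟨m, ?_, by simp [hm0]⟩
      have := hpos m hmC
      simp only [Finset.mem_filter, Finset.mem_univ, true_and]
      rintro h
      simp [h] at this
    · intro e he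
      simp only [Finset.mem_filter, Finset.mem_univ, true_and] at he ⊢
      rcases lt_or_gt_of_ne he with h | h
      · exact (hsupp' e h).ne
      · exact (hsupp e h).ne'
  have hsub : o.conformalCircuits f' ⊆ o.conformalCircuits f := by
    rintro c' ⟨C', hc', h⟩
    refine ⟨C', hc', fun e he => ?_⟩
    rcases pos_and_pos_or_neg_and_neg_of_mul_pos (h e he) with ⟨h1, h2⟩ | ⟨h1, h2⟩
    · exact mul_pos h1 (hsupp e h2)
    · exact mul_pos_of_neg_of_neg h1 (hsupp' e h2)
  have h1 := Submodule.span_mono (R := ℝ≥0) hsub (ih _ hlt hf' rfl)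
  have h2 : f = f' + r • c := by simp [f']
  rw [h2]
  rw [h2] at h1 hpos
  exact Submodule.add_mem _ h1 (Submodule.smul_mem _ _ (Submodule.subset_span ⟨C, hc, hpos⟩))

theorem span_flowLattice (o : G.EdgeOrientation) :
    Submodule.span ℝ (o.flowLattice : Set (EuclideanSpace ℝ E(G))) = o.realFlows := by
  refine le_antisymm (Submodule.span_le.2 fun f hf => (mem_flowLattice_iff.1 hf).2) fun f hf => ?_
  refine Submodule.span_induction (R := NNReal)
    (p := fun f _ => f ∈ Submodule.span ℝ (o.flowLattice : Set (EuclideanSpace ℝ E(G)))) ?_ (zero_mem _)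
    (fun _ _ _ _ h h' => add_mem h h') (fun r _ _ h => Submodule.smul_mem _ (r : ℝ) h)
    (mem_span_conformalCircuits hf)
  rintro c ⟨C, hc, -⟩
  exact Submodule.subset_span hc.mem_flowLattice

/-! ### Support function and faces of the Voronoi cell -/

theorem mem_flowVoronoiCell {o : G.EdgeOrientation} {x : EuclideanSpace ℝ E(G)} :
    x ∈ o.flowVoronoiCell ↔
      x ∈ o.realFlows ∧ ∀ y ∈ o.flowLattice, inner ℝ x y ≤ inner ℝ y y / 2 := by
  rw [flowVoronoiCell, voronoiCell, Set.mem_ofPred_eq, span_flowLattice]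
  refine and_congr_right fun _ => forall₂_congr fun y _ => ?_
  rw [← sq_le_sq₀ (norm_nonneg _) (norm_nonneg _), @norm_sub_sq_real, real_inner_self_eq_norm_sq]
  constructor <;> intro h <;> linarith

/-- The part of the Voronoi cell where the functional given by the flow `f` attains its
maximum. -/
def supportFace (o : G.EdgeOrientation) (f : EuclideanSpace ℝ E(G)) :
    Set (EuclideanSpace ℝ E(G)) :=
  {x ∈ o.flowVoronoiCell | inner ℝ x f = (∑ e, |f e|) / 2}

/-- The sign of a coordinate, as a real number. -/
noncomputable def signAt (f : EuclideanSpace ℝ E(G)) (e : E(G)) : ℝ := (SignType.sign (f e) : ℝ)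

omit [Fintype E(G)] in
theorem signAt_mul_self (f : EuclideanSpace ℝ E(G)) (e : E(G)) : signAt f e * f e = |f e| :=
  sign_mul_self _

omit [Fintype E(G)] in
theorem abs_signAt_le (f : EuclideanSpace ℝ E(G)) (e : E(G)) : |signAt f e| ≤ 1 := by
  unfold signAt
  rcases lt_trichotomy (f e) 0 with h | h | h <;> simp [h]

omit [Fintype E(G)] in
theorem IsCircuitElement.signAt_mul {o : G.EdgeOrientation} {C : Set E(G)}
    {c f : EuclideanSpace ℝ E(G)} (hc : o.IsCircuitElement C c) (h : ∀ e ∈ C, 0 < c e * f e)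
    (e : E(G)) : signAt f e * c e = |c e| := by
  by_cases he : e ∈ C
  · have := h e he
    unfold signAt
    rcases hc.eq_one_or_neg_one he with h1 | h1 <;> rw [h1] at this ⊢
    · rw [sign_pos (by linarith)]; simp
    · rw [sign_neg (by linarith)]; simp
  · simp [hc.eq_zero he]

theorem IsCircuitElement.inner_self {o : G.EdgeOrientation} {C : Set E(G)}
    {c : EuclideanSpace ℝ E(G)} (hc : o.IsCircuitElement C c) :
    inner ℝ c c = ∑ e, |c e| := by
  rw [inner_eq_sum]
  exact Finset.sum_congr rfl fun e _ => hc.sq_eq_abs e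

theorem IsCircuitElement.supportFace_eq {o : G.EdgeOrientation} {C : Set E(G)}
    {c : EuclideanSpace ℝ E(G)} (hc : o.IsCircuitElement C c) :
    o.supportFace c = o.bisectorFace c := by
  rw [supportFace, bisectorFace, hc.inner_self]

theorem inner_le_of_mem_flowVoronoiCell {o : G.EdgeOrientation} {x f : EuclideanSpace ℝ E(G)}
    (hx : x ∈ o.flowVoronoiCell) (hf : f ∈ o.realFlows) :
    inner ℝ x f ≤ (∑ e, |f e|) / 2 := by
  -- With the signs of `f` frozen, both sides are linear in `g`, so conformal circuits suffice.
  have key : inner ℝ x f ≤ (∑ e, signAt f e * f e) / 2 := by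
    refine Submodule.span_induction (R := NNReal)
      (p := fun g _ => inner ℝ x g ≤ (∑ e, signAt f e * g e) / 2) ?_ (by simp) ?_ ?_
      (mem_span_conformalCircuits hf)
    · rintro c ⟨C, hc, h⟩
      rw [Finset.sum_congr rfl fun e _ => hc.signAt_mul h e, ← hc.inner_self]
      exact (mem_flowVoronoiCell.1 hx).2 c hc.mem_flowLattice
    · intro a b _ _ ha hb
      simp only [inner_add_right, PiLp.add_apply, mul_add, Finset.sum_add_distrib]
      linarith
    · intro r a _ ha
      have h1 : inner ℝ x (r • a) = (r : ℝ) * inner ℝ x a := inner_smul_right _ _ (r : ℝ)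
      have h2 : ∑ e, signAt f e * (r • a) e = r * ∑ e, signAt f e * a e := by
        rw [Finset.mul_sum]
        refine Finset.sum_congr rfl fun e _ => ?_
        have : (r • a) e = (r : ℝ) * a e := rfl
        rw [this]; ring
      rw [h1, h2, mul_div_assoc]
      exact mul_le_mul_of_nonneg_left ha r.2
  simpa only [signAt_mul_self] using key

theorem inner_starProjection {o : G.EdgeOrientation} (t : EuclideanSpace ℝ E(G))
    {f : EuclideanSpace ℝ E(G)} (hf : f ∈ o.realFlows) :
    inner ℝ (o.realFlows.starProjection t) f = inner ℝ t f := by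
  rw [Submodule.inner_starProjection_left_eq_right, Submodule.starProjection_eq_self_iff.2 hf]

/-- Integers satisfy `|n| ≤ n²`, so the Voronoi inequalities hold for `t` coordinate by coordinate;
projecting does not change products with flows. -/
theorem starProjection_mem_flowVoronoiCell {o : G.EdgeOrientation} {t : EuclideanSpace ℝ E(G)}
    (ht : ∀ e, |t e| ≤ 1 / 2) : o.realFlows.starProjection t ∈ o.flowVoronoiCell := by
  refine mem_flowVoronoiCell.2 ⟨Submodule.starProjection_apply_mem _ _, fun y hy => ?_⟩
  obtain ⟨hy, hyW⟩ := mem_flowLattice_iff.1 hy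
  rw [inner_starProjection t hyW, inner_eq_sum, inner_eq_sum, Finset.sum_div]
  refine Finset.sum_le_sum fun e _ => ?_
  obtain ⟨n, hn⟩ := hy e
  have h1 : |y e| ≤ y e * y e := by
    have h0 : |n| ≤ n * n := by
      rw [← abs_mul_abs_self]
      nlinarith [abs_nonneg n, Int.le_self_sq |n|]
    have h0' : |(n : ℝ)| ≤ n * n := by exact_mod_cast h0
    rw [hn]
    exact h0'
  calc t e * y e ≤ |t e| * |y e| := (le_abs_self _).trans (abs_mul _ _).le
    _ ≤ 1 / 2 * (y e * y e) := mul_le_mul (ht e) h1 (abs_nonneg _) (by norm_num)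
    _ = _ := by ring

/-- The coordinates of `t` off the support of `f` stay free; moving them yields the directions of
the face. -/
theorem starProjection_mem_supportFace {o : G.EdgeOrientation} {t f : EuclideanSpace ℝ E(G)}
    (hf : f ∈ o.realFlows) (ht : ∀ e, |t e| ≤ 1 / 2)
    (htf : ∀ e, f e ≠ 0 → t e = signAt f e / 2) :
    o.realFlows.starProjection t ∈ o.supportFace f := by
  refine ⟨starProjection_mem_flowVoronoiCell ht, ?_⟩
  rw [inner_starProjection t hf, inner_eq_sum, Finset.sum_div]
  refine Finset.sum_congr rfl fun e _ => ?_
  rw [← signAt_mul_self]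
  by_cases h : f e = 0
  · simp [h]
  · rw [htf e h]; ring

theorem supportFace_nonempty {o : G.EdgeOrientation} {f : EuclideanSpace ℝ E(G)}
    (hf : f ∈ o.realFlows) : (o.supportFace f).Nonempty := by
  refine ⟨_, starProjection_mem_supportFace (t := WithLp.toLp 2 fun e => signAt f e / 2) hf
    (fun e => ?_) fun e _ => rfl⟩
  simp only [abs_div, abs_two]
  linarith [abs_signAt_le f e]

/-- On the face given by a flow `f`, the inner products with the flows supported on the support
of `f` are constant. -/
theorem inner_eq_of_mem_supportFace {o : G.EdgeOrientation} {x f g : EuclideanSpace ℝ E(G)}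
    (hx : x ∈ o.supportFace f) (hf : f ∈ o.realFlows) (hg : g ∈ o.realFlows)
    (hgf : ∀ e, f e = 0 → g e = 0) : inner ℝ x g = (∑ e, signAt f e * g e) / 2 := by
  -- For such `δ` the vectors `f ± δ g` reverse no sign of `f`, so the `ℓ¹` norm is affine between
  -- them; the support bound at both ends forces equality.
  obtain ⟨δ, hδ, hδf⟩ : ∃ δ : ℝ, 0 < δ ∧ ∀ e, δ * |g e| ≤ |f e| := by
    have hδ (e : E(G)) : ∃ δ : ℝ, 0 < δ ∧ δ * |g e| ≤ |f e| := by
      by_cases h : f e = 0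
      · exact ⟨1, one_pos, by simp [h, hgf e h]⟩
      · refine ⟨|f e| / (|g e| + 1), by positivity, ?_⟩
        rw [div_mul_eq_mul_div, div_le_iff₀ (by positivity)]
        nlinarith [abs_nonneg (f e), abs_nonneg (g e)]
    choose δ hδ hδf using hδ
    obtain ⟨d, hd, hd'⟩ : ∃ d : ℝ, 0 < d ∧ ∀ e, d ≤ δ e := by
      cases isEmpty_or_nonempty E(G)
      · exact ⟨1, one_pos, fun e => isEmptyElim e⟩
      · obtain ⟨e, he⟩ := Finite.exists_min δ
        exact ⟨δ e, hδ e, he⟩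
    exact ⟨d, hd, fun e => (mul_le_mul_of_nonneg_right (hd' e) (abs_nonneg _)).trans (hδf e)⟩
  have key (r : ℝ) (hr : |r| = δ) : r * inner ℝ x g ≤ r * ((∑ e, signAt f e * g e) / 2) := by
    have h1 := inner_le_of_mem_flowVoronoiCell hx.1
      (Submodule.add_mem _ hf (Submodule.smul_mem _ r hg))
    have h2 (e : E(G)) : |(f + r • g) e| = |f e| + r * (signAt f e * g e) := by
      have h3 : |r * g e| ≤ |f e| := by rw [abs_mul, hr]; exact hδf e
      have h4 := abs_le.1 h3
      simp only [PiLp.add_apply, PiLp.smul_apply, smul_eq_mul, signAt]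
      rcases lt_trichotomy (f e) 0 with h | h | h
      · rw [abs_of_neg h] at h4 ⊢
        rw [abs_of_nonpos (by linarith)]
        simp [h]; ring
      · simp [h, hgf e h]
      · rw [abs_of_pos h] at h4 ⊢
        rw [abs_of_nonneg (by linarith)]
        simp [h]
    rw [inner_add_right, real_inner_smul_right, hx.2, Finset.sum_congr rfl fun e _ => h2 e,
      Finset.sum_add_distrib, ← Finset.mul_sum] at h1
    linarith
  have h1 := key δ (abs_of_pos hδ)
  have h2 := key (-δ) (by rw [abs_neg, abs_of_pos hδ])
  refine le_antisymm (le_of_mul_le_mul_left h1 hδ) (le_of_mul_le_mul_left ?_ hδ)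
  linarith

theorem supportFace_smul (o : G.EdgeOrientation) (f : EuclideanSpace ℝ E(G)) {r : ℝ}
    (hr : 0 < r) : o.supportFace (r • f) = o.supportFace f := by
  ext x
  refine and_congr_right fun _ => ?_
  simp only [real_inner_smul_right, PiLp.smul_apply, smul_eq_mul, abs_mul, abs_of_pos hr,
    ← Finset.mul_sum, mul_div_assoc]
  exact mul_right_inj' hr.ne'

/-- The cell lies in the space of flows, so only the projection `f` of a functional to that space
matters; its maximum is half the `ℓ¹` norm of `f`. -/
theorem isFaceOfPolytope_iff {o : G.EdgeOrientation} {F : Set (EuclideanSpace ℝ E(G))} :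
    IsFaceOfPolytope o.flowVoronoiCell F ↔ ∃ f ∈ o.realFlows, F = o.supportFace f := by
  constructor
  · rintro ⟨hne, hF⟩
    obtain ⟨l, rfl⟩ := hF hne
    obtain ⟨w, rfl⟩ := (InnerProductSpace.toDual ℝ (EuclideanSpace ℝ E(G))).surjective l
    have hW := Submodule.starProjection_apply_mem o.realFlows w
    refine ⟨_, hW, ?_⟩
    set f := o.realFlows.starProjection w with hf
    have hl (x) (hx : x ∈ o.flowVoronoiCell) : inner ℝ w x = inner ℝ x f := by
      rw [← inner_starProjection w (mem_flowVoronoiCell.1 hx).1, real_inner_comm]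
    obtain ⟨z, hz, hz'⟩ := supportFace_nonempty hW
    ext x
    refine and_congr_right fun hx => ?_
    simp only [InnerProductSpace.toDual_apply_apply, hl x hx]
    constructor
    · intro h
      have := h z hz
      rw [hl z hz] at this
      exact le_antisymm (inner_le_of_mem_flowVoronoiCell hx hW) (hz'.ge.trans this)
    · intro h y hy
      rw [h, hl y hy]
      exact inner_le_of_mem_flowVoronoiCell hy hW
  · rintro ⟨f, hf, rfl⟩
    obtain ⟨z, hz, hz'⟩ := supportFace_nonempty hf
    refine ⟨⟨z, hz, hz'⟩, fun _ => ⟨InnerProductSpace.toDual ℝ _ f, ?_⟩⟩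
    ext x
    refine and_congr_right fun hx => ?_
    simp only [InnerProductSpace.toDual_apply_apply, real_inner_comm _ f]
    constructor
    · intro h y hy
      rw [h]
      exact inner_le_of_mem_flowVoronoiCell hy hf
    · intro h
      exact le_antisymm (inner_le_of_mem_flowVoronoiCell hx hf) (hz'.ge.trans (h z hz))

/-! ### Directions and dimensions of faces -/

/-- The flows supported on the support of `f`. -/
def flowsUnder (o : G.EdgeOrientation) (f : EuclideanSpace ℝ E(G)) :
    Submodule ℝ (EuclideanSpace ℝ E(G)) where
  carrier := {g | g ∈ o.realFlows ∧ ∀ e, f e = 0 → g e = 0}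
  zero_mem' := ⟨zero_mem _, by simp⟩
  add_mem' := fun ha hb => ⟨add_mem ha.1 hb.1, fun e he => by simp [ha.2 e he, hb.2 e he]⟩
  smul_mem' := fun c _ ha => ⟨Submodule.smul_mem _ c ha.1, fun e he => by simp [ha.2 e he]⟩

theorem mem_flowsUnder {o : G.EdgeOrientation} {f g : EuclideanSpace ℝ E(G)} :
    g ∈ o.flowsUnder f ↔ g ∈ o.realFlows ∧ ∀ e, f e = 0 → g e = 0 := Iff.rfl

theorem flowsUnder_le (o : G.EdgeOrientation) (f : EuclideanSpace ℝ E(G)) :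
    o.flowsUnder f ≤ o.realFlows := fun _ h => h.1

open Classical in
/-- The projection of a basis vector to the space of flows. -/
noncomputable def edgeProj (o : G.EdgeOrientation) (e : E(G)) : EuclideanSpace ℝ E(G) :=
  o.realFlows.starProjection (EuclideanSpace.single e 1)

theorem edgeProj_mem (o : G.EdgeOrientation) (e : E(G)) : o.edgeProj e ∈ o.realFlows :=
  Submodule.starProjection_apply_mem _ _

theorem inner_edgeProj {o : G.EdgeOrientation} {f : EuclideanSpace ℝ E(G)}
    (hf : f ∈ o.realFlows) (e : E(G)) : inner ℝ (o.edgeProj e) f = f e := by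
  classical
  rw [edgeProj, inner_starProjection _ hf, EuclideanSpace.inner_single_left]
  simp

theorem edgeProj_mem_vectorSpan {o : G.EdgeOrientation} {f : EuclideanSpace ℝ E(G)}
    (hf : f ∈ o.realFlows) {e : E(G)} (he : f e = 0) :
    o.edgeProj e ∈ vectorSpan ℝ (o.supportFace f) := by
  classical
  -- The `e`-th coordinate is zero here and can move to `1/2` inside the cube; the difference of the
  -- projections is half of `edgeProj e`.
  let t : EuclideanSpace ℝ E(G) := WithLp.toLp 2 fun e => signAt f e / 2
  have ht (e) : |t e| ≤ 1 / 2 := by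
    simp only [t, abs_div, abs_two]
    linarith [abs_signAt_le f e]
  have h1 := starProjection_mem_supportFace hf ht fun e _ => rfl
  have h2 : o.realFlows.starProjection (t + (1 / 2 : ℝ) • EuclideanSpace.single e 1) ∈
      o.supportFace f := by
    refine starProjection_mem_supportFace hf (fun a => ?_) fun a ha => ?_
    · by_cases hae : a = e
      · subst hae; simp [t, signAt, he]
      · simpa [hae] using ht a
    · have hae : a ≠ e := by rintro rfl; exact ha he
      simp [t, hae]
  have h3 := vsub_mem_vectorSpan ℝ h2 h1
  rw [vsub_eq_sub, map_add, add_sub_cancel_left, map_smul] at h3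
  exact (Submodule.smul_mem_iff _ (by norm_num)).1 h3

theorem vectorSpan_supportFace {o : G.EdgeOrientation} {f : EuclideanSpace ℝ E(G)}
    (hf : f ∈ o.realFlows) :
    vectorSpan ℝ (o.supportFace f) = (o.flowsUnder f)ᗮ ⊓ o.realFlows := by
  classical
  apply le_antisymm
  · rw [vectorSpan, Submodule.span_le]
    rintro _ ⟨x, hx, y, hy, rfl⟩
    refine ⟨(Submodule.mem_orthogonal' _ _).2 fun g hg => ?_,
      sub_mem (mem_flowVoronoiCell.1 hx.1).1 (mem_flowVoronoiCell.1 hy.1).1⟩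
    change inner ℝ (x - y) g = 0
    rw [inner_sub_left, inner_eq_of_mem_supportFace hx hf hg.1 hg.2,
      inner_eq_of_mem_supportFace hy hf hg.1 hg.2, sub_self]
  · rintro x ⟨hx, hxW⟩
    -- A vector `y` orthogonal to the face is orthogonal to each `edgeProj e` with `f e = 0`; hence
    -- its projection to flows vanishes at these `e` and lies in `flowsUnder f`.
    rw [← Submodule.orthogonal_orthogonal (vectorSpan ℝ (o.supportFace f))]
    refine (Submodule.mem_orthogonal _ _).2 fun y hy => ?_
    rw [← inner_starProjection y hxW]
    refine (Submodule.mem_orthogonal _ _).1 hx _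
      ⟨Submodule.starProjection_apply_mem _ _, fun e he => ?_⟩
    rw [← inner_edgeProj (Submodule.starProjection_apply_mem _ _), real_inner_comm,
      inner_starProjection _ (edgeProj_mem o e), real_inner_comm]
    exact (Submodule.mem_orthogonal _ _).1 hy _ (edgeProj_mem_vectorSpan hf he)

theorem finrank_flowsUnder_add_affDim {o : G.EdgeOrientation} {f : EuclideanSpace ℝ E(G)}
    (hf : f ∈ o.realFlows) :
    Module.finrank ℝ (o.flowsUnder f) + affDim (o.supportFace f) =
      Module.finrank ℝ o.realFlows := by
  rw [affDim, vectorSpan_supportFace hf]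
  exact Submodule.finrank_add_inf_finrank_orthogonal (o.flowsUnder_le f)

theorem flowsUnder_zero (o : G.EdgeOrientation) : o.flowsUnder 0 = ⊥ := by
  refine eq_bot_iff.2 fun g hg => ?_
  rw [Submodule.mem_bot]
  ext e
  exact hg.2 e rfl

theorem affDim_flowVoronoiCell (o : G.EdgeOrientation) :
    affDim o.flowVoronoiCell = Module.finrank ℝ o.realFlows := by
  have h1 : o.flowVoronoiCell = o.supportFace 0 := by simp [supportFace]
  have := finrank_flowsUnder_add_affDim (zero_mem o.realFlows)
  rw [flowsUnder_zero, finrank_bot, zero_add] at this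
  rw [h1, this]

/-- Double complement relative to `W`: a face direction thus determines `flowsUnder f`. -/
theorem orthogonal_inf_orthogonal_inf {E : Type*} [NormedAddCommGroup E] [InnerProductSpace ℝ E]
    [FiniteDimensional ℝ E] {A W : Submodule ℝ E} (h : A ≤ W) : (Aᗮ ⊓ W)ᗮ ⊓ W = A := by
  have : Aᗮ ⊓ W = (A ⊔ Wᗮ)ᗮ := by
    rw [← Submodule.inf_orthogonal, Submodule.orthogonal_orthogonal]
  rw [this, Submodule.orthogonal_orthogonal, sup_inf_assoc_of_le _ h, inf_comm,
    Submodule.inf_orthogonal_eq_bot, sup_bot_eq]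

theorem vectorSpan_supportFace_eq_iff {o : G.EdgeOrientation} {f g : EuclideanSpace ℝ E(G)}
    (hf : f ∈ o.realFlows) (hg : g ∈ o.realFlows) :
    vectorSpan ℝ (o.supportFace f) = vectorSpan ℝ (o.supportFace g) ↔
      o.flowsUnder f = o.flowsUnder g := by
  rw [vectorSpan_supportFace hf, vectorSpan_supportFace hg]
  refine ⟨fun h => ?_, fun h => by rw [h]⟩
  rw [← orthogonal_inf_orthogonal_inf (o.flowsUnder_le f), h,
    orthogonal_inf_orthogonal_inf (o.flowsUnder_le g)]

/-! ### Facets -/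

theorem IsCircuitElement.flowsUnder_eq {o : G.EdgeOrientation} {C : Set E(G)}
    {c : EuclideanSpace ℝ E(G)} (hc : o.IsCircuitElement C c) :
    o.flowsUnder c = Submodule.span ℝ {c} := by
  refine le_antisymm (fun g hg => ?_) ?_
  · obtain ⟨r, rfl⟩ := hc.eq_smul hg.1 fun e he => hg.2 e (hc.eq_zero he)
    exact Submodule.mem_span_singleton.2 ⟨r, rfl⟩
  · rw [Submodule.span_singleton_le_iff_mem]
    exact ⟨hc.mem_realFlows, fun _ h => h⟩

theorem mem_polytopeFacets_iff {o : G.EdgeOrientation} {F : Set (EuclideanSpace ℝ E(G))} :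
    F ∈ polytopeFacets o.flowVoronoiCell ↔
      ∃ C c, o.IsCircuitElement C c ∧ F = o.supportFace c := by
  simp only [polytopeFacets, Set.mem_ofPred_eq, isFaceOfPolytope_iff, affDim_flowVoronoiCell]
  constructor
  · rintro ⟨⟨f, hf, rfl⟩, hdim⟩
    have h1 : Module.finrank ℝ (o.flowsUnder f) = 1 := by
      have := finrank_flowsUnder_add_affDim hf
      omega
    have hff : f ∈ o.flowsUnder f := ⟨hf, fun _ h => h⟩
    have hf0 : f ≠ 0 := by
      rintro rfl
      rw [flowsUnder_zero] at h1
      simp at h1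
    -- A conformal circuit spans the line `flowsUnder f`; agreement in sign makes the scalar
    -- positive.
    obtain ⟨C, c, hc, hpos⟩ := exists_conformal_circuit hf hf0
    have hcf : c ∈ o.flowsUnder f := by
      refine ⟨hc.mem_realFlows, fun e he => hc.eq_zero fun heC => ?_⟩
      have := hpos e heC
      simp [he] at this
    obtain ⟨r, hr⟩ := exists_smul_eq_of_finrank_eq_one h1
      (x := (⟨c, hcf⟩ : o.flowsUnder f)) (by simpa using hc.ne_zero) ⟨f, hff⟩
    have hr' : r • c = f := congrArg Subtype.val hr
    obtain ⟨e, he⟩ := hc.nonempty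
    have hrpos : 0 < r := by
      have := hpos e he
      rw [← hr'] at this
      simp only [PiLp.smul_apply, smul_eq_mul] at this
      nlinarith [mul_self_nonneg (c e)]
    exact ⟨C, c, hc, by rw [← hr', supportFace_smul o c hrpos]⟩
  · rintro ⟨C, c, hc, rfl⟩
    refine ⟨⟨c, hc.mem_realFlows, rfl⟩, ?_⟩
    have := finrank_flowsUnder_add_affDim hc.mem_realFlows
    rw [hc.flowsUnder_eq, finrank_span_singleton hc.ne_zero] at this
    omega

theorem vectorSpan_supportFace_circuit_eq_iff {o : G.EdgeOrientation} {C C' : Set E(G)}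
    {c c' : EuclideanSpace ℝ E(G)} (hc : o.IsCircuitElement C c)
    (hc' : o.IsCircuitElement C' c') :
    vectorSpan ℝ (o.supportFace c) = vectorSpan ℝ (o.supportFace c') ↔ C = C' := by
  rw [vectorSpan_supportFace_eq_iff hc.mem_realFlows hc'.mem_realFlows]
  constructor
  · intro h
    have h1 : c ∈ o.flowsUnder c' := h ▸ ⟨hc.mem_realFlows, fun _ h => h⟩
    have h2 : c' ∈ o.flowsUnder c := h ▸ ⟨hc'.mem_realFlows, fun _ h => h⟩
    ext e
    rw [← hc.ne_zero_iff, ← hc'.ne_zero_iff]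
    exact not_congr ⟨h2.2 e, h1.2 e⟩
  · rintro rfl
    ext g
    simp only [mem_flowsUnder]
    refine and_congr_right fun _ => forall_congr' fun e => ?_
    rw [← not_ne_iff, hc.ne_zero_iff, ← hc'.ne_zero_iff, not_ne_iff]

omit [Fintype E(G)] in
theorem exists_isCircuitElement (o : G.EdgeOrientation) {C : Set E(G)} (hC : G.IsCircuit C) :
    ∃ c, o.IsCircuitElement C c := by
  classical
  obtain ⟨k, v, w, hvw, rfl⟩ := hC
  -- A loop fits both directions and gets the value `1`.
  refine ⟨WithLp.toLp 2 fun e => if e ∈ Set.range w then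
    (if ∃ i, w i = e ∧ o.tail e = v i ∧ o.head e = v (i + 1) then 1 else -1) else 0,
    k, v, w, hvw, rfl, fun e he => by simp [he], fun i => ?_⟩
  by_cases h : o.tail (w i) = v i ∧ o.head (w i) = v (i + 1)
  · left
    have : ∃ j, w j = w i ∧ o.tail (w i) = v j ∧ o.head (w i) = v (j + 1) := ⟨i, rfl, h⟩
    exact ⟨by simp [this], h⟩
  · right
    have : ¬ ∃ j, w j = w i ∧ o.tail (w i) = v j ∧ o.head (w i) = v (j + 1) := by
      rintro ⟨j, hj, h'⟩
      rw [hvw.2.1 hj] at h'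
      exact h h'
    refine ⟨by simp only [Set.mem_range_self, if_true, if_neg this], ?_⟩
    rcases (o.isLink (w i)).eq_and_eq_or_eq_and_eq (hvw.2.2 i) with h' | h'
    · exact absurd h' h
    · exact h'

/-! ### Flows from paths, and strong orientations -/

/-- The vector `p` has net inflow `1` at `v` and net outflow `1` at `u`. -/
def IsUnitFlow (o : G.EdgeOrientation) (u v : α) (p : EuclideanSpace ℝ E(G)) : Prop :=
  ∀ φ : α → ℝ, ∑ e, p e * (φ (o.head e) - φ (o.tail e)) = φ v - φ u

theorem IsUnitFlow.add {o : G.EdgeOrientation} {u v w : α} {p q : EuclideanSpace ℝ E(G)}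
    (hp : o.IsUnitFlow u v p) (hq : o.IsUnitFlow v w q) : o.IsUnitFlow u w (p + q) := by
  intro φ
  simp only [PiLp.add_apply, add_mul, Finset.sum_add_distrib, hp φ, hq φ]
  ring

theorem IsUnitFlow.mem_realFlows {o : G.EdgeOrientation} {u : α} {p : EuclideanSpace ℝ E(G)}
    (hp : o.IsUnitFlow u u p) : p ∈ o.realFlows := fun φ => by rw [hp φ, sub_self]

open Classical in
theorem isUnitFlow_single (o : G.EdgeOrientation) (e : E(G)) :
    o.IsUnitFlow (o.tail e) (o.head e) (EuclideanSpace.single e 1) := by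
  intro φ
  rw [Finset.sum_eq_single e] <;> simp +contextual

open Classical in
theorem isUnitFlow_single_neg (o : G.EdgeOrientation) (e : E(G)) :
    o.IsUnitFlow (o.head e) (o.tail e) (EuclideanSpace.single e (-1)) := by
  intro φ
  rw [Finset.sum_eq_single e] <;> simp +contextual

/-- The submonoid `Q` carries along a path any additive constraint, such as prescribed signs or
vanishing on given edges. -/
theorem exists_isUnitFlow_of_reflTransGen {o : G.EdgeOrientation} {r : α → α → Prop}
    (Q : AddSubmonoid (EuclideanSpace ℝ E(G)))
    (h : ∀ a b, r a b → ∃ p ∈ Q, o.IsUnitFlow a b p) {u v : α}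
    (huv : Relation.ReflTransGen r u v) : ∃ p ∈ Q, o.IsUnitFlow u v p := by
  induction huv with
  | refl => exact ⟨0, Q.zero_mem, fun φ => by simp⟩
  | tail _ hbc ih =>
    obtain ⟨p, hp, hp'⟩ := ih
    obtain ⟨q, hq, hq'⟩ := h _ _ hbc
    exact ⟨p + q, Q.add_mem hp hq, hp'.add hq'⟩

/-- A strong orientation supports a flow which is positive on all edges. -/
theorem IsStrongOn.exists_flow {o : G.EdgeOrientation} {H : Set E(G)} {σ : E(G) → ℤˣ}
    (hσ : o.IsStrongOn H σ) :
    ∃ f ∈ o.realFlows, (∀ e ∉ H, f e = 0) ∧ ∀ e ∈ H, 0 < ((σ e : ℤ) : ℝ) * f e := by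
  classical
  let Q : AddSubmonoid (EuclideanSpace ℝ E(G)) :=
    { carrier := {p | (∀ e ∉ H, p e = 0) ∧ ∀ e, 0 ≤ ((σ e : ℤ) : ℝ) * p e}
      zero_mem' := by simp
      add_mem' := fun {a b} ha hb => ⟨fun e he => by simp [ha.1 e he, hb.1 e he], fun e => by
        simp only [PiLp.add_apply, mul_add]
        exact add_nonneg (ha.2 e) (hb.2 e)⟩ }
  have hone {e : E(G)} {r : ℝ} (he : e ∈ H) (hr : r = ((σ e : ℤ) : ℝ)) :
      EuclideanSpace.single e r ∈ Q := by
    refine ⟨fun a ha => ?_, fun a => ?_⟩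
    · have : a ≠ e := by rintro rfl; exact ha he
      simp [this]
    · by_cases h : a = e
      · subst h
        simp [hr, mul_self_nonneg]
      · simp [h]
  have hstep (a b : α) (hab : o.DirectedStepIn H σ a b) : ∃ p ∈ Q, o.IsUnitFlow a b p := by
    obtain ⟨e, he, ⟨h1, rfl, rfl⟩ | ⟨h1, rfl, rfl⟩⟩ := hab
    · exact ⟨_, hone he (by simp [h1]), isUnitFlow_single o e⟩
    · exact ⟨_, hone he (by simp [h1]), isUnitFlow_single_neg o e⟩
  -- A directed path back from the end of `e` to its start closes up with `e`; the sum of these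
  -- flows over `H` is positive everywhere on `H`.
  have hedge (e : E(G)) (he : e ∈ H) : ∃ f ∈ Q, f ∈ o.realFlows ∧ 0 < ((σ e : ℤ) : ℝ) * f e := by
    have hlink := o.isLink e
    rcases Int.units_eq_one_or (σ e) with h1 | h1
    · obtain ⟨p, hp, hp'⟩ := exists_isUnitFlow_of_reflTransGen Q hstep
        (hσ _ hlink.right_mem _ hlink.left_mem (.single ⟨e, he, hlink.symm⟩))
      refine ⟨_, Q.add_mem hp (hone he (r := 1) (by simp [h1])),
        (hp'.add (isUnitFlow_single o e)).mem_realFlows, ?_⟩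
      have := hp.2 e
      simp only [h1] at this
      simp [h1] at this ⊢
      linarith
    · obtain ⟨p, hp, hp'⟩ := exists_isUnitFlow_of_reflTransGen Q hstep
        (hσ _ hlink.left_mem _ hlink.right_mem (.single ⟨e, he, hlink⟩))
      refine ⟨_, Q.add_mem hp (hone he (r := -1) (by simp [h1])),
        (hp'.add (isUnitFlow_single_neg o e)).mem_realFlows, ?_⟩
      have := hp.2 e
      simp [h1] at this ⊢
      linarith
  choose! g hgQ hgW hgpos using hedge
  refine ⟨∑ e with e ∈ H, g e, sum_mem fun e he => hgW e (by simpa using he), ?_, fun e he => ?_⟩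
  · exact (Q.sum_mem fun e he => hgQ e (by simpa using he) : ∑ e with e ∈ H, g e ∈ Q).1
  · have : (∑ a with a ∈ H, g a) e = ∑ a with a ∈ H, g a e := by simp
    rw [this, Finset.mul_sum]
    refine Finset.sum_pos' (fun a ha => (hgQ a (by simpa using ha)).2 e) ⟨e, by simpa using he, ?_⟩
    exact hgpos e he

/-- An orientation that supports a positive flow is strong. -/
theorem isStrongOn_of_flow {o : G.EdgeOrientation} {H : Set E(G)} {σ : E(G) → ℤˣ}
    {f : EuclideanSpace ℝ E(G)} (hf : f ∈ o.realFlows) (hf0 : ∀ e ∉ H, f e = 0)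
    (hfH : ∀ e ∈ H, 0 < ((σ e : ℤ) : ℝ) * f e) : o.IsStrongOn H σ := by
  classical
  have key (u : α) (e : E(G)) (he : e ∈ H) :
      Relation.ReflTransGen (o.DirectedStepIn H σ) u (o.head e) ↔
        Relation.ReflTransGen (o.DirectedStepIn H σ) u (o.tail e) := by
    -- The indicator of the vertices reachable from `u` never decreases along `σ`, so every term of
    -- the conservation sum is nonnegative, hence zero: no edge of `H` crosses the boundary of this
    -- set.
    let φ : α → ℝ := fun v => if Relation.ReflTransGen (o.DirectedStepIn H σ) u v then 1 else 0
    have hφ {v w : α} (h : o.DirectedStepIn H σ v w) : φ v ≤ φ w := by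
      by_cases hv : Relation.ReflTransGen (o.DirectedStepIn H σ) u v
      · simp [φ, hv, hv.tail h]
      · simp only [φ, hv, if_false]; split_ifs <;> norm_num
    have hnn (a : E(G)) : 0 ≤ f a * (φ (o.head a) - φ (o.tail a)) := by
      by_cases ha : a ∈ H
      · have hpos := hfH a ha
        rcases Int.units_eq_one_or (σ a) with h1 | h1
        · have := hφ ⟨a, ha, .inl ⟨h1, rfl, rfl⟩⟩
          simp [h1] at hpos
          exact mul_nonneg hpos.le (by linarith)
        · have := hφ ⟨a, ha, .inr ⟨h1, rfl, rfl⟩⟩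
          simp [h1] at hpos
          exact mul_nonneg_of_nonpos_of_nonpos hpos.le (by linarith)
      · simp [hf0 a ha]
    have h0 := (Finset.sum_eq_zero_iff_of_nonneg fun a _ => hnn a).1 (hf φ) e (Finset.mem_univ _)
    have hfe : f e ≠ 0 := by
      intro h
      have := hfH e he
      simp [h] at this
    have h1 : φ (o.head e) = φ (o.tail e) :=
      sub_eq_zero.1 ((mul_eq_zero.1 h0).resolve_left hfe)
    simp only [φ] at h1
    split_ifs at h1 with h2 h3 h3
    · exact iff_of_true h2 h3
    · norm_num at h1
    · norm_num at h1
    · exact iff_of_false h2 h3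
  rintro u - v - huv
  induction huv with
  | refl => exact .refl
  | tail _ hbc ih =>
    obtain ⟨e, he, hlink⟩ := hbc
    rcases (o.isLink e).eq_and_eq_or_eq_and_eq hlink with ⟨rfl, rfl⟩ | ⟨rfl, rfl⟩
    · exact (key u e he).2 ih
    · exact (key u e he).1 ih

/-- The circuits conformal to `f` are exactly those in `H` directed by `σ`. They generate `f` as a
cone, and conversely they are supported under `f`, where inner products are constant on the face. -/
theorem orientedSubgraphFace_eq_supportFace {o : G.EdgeOrientation} {H : Set E(G)}
    {σ : E(G) → ℤˣ} {f : EuclideanSpace ℝ E(G)} (hf : f ∈ o.realFlows)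
    (hf0 : ∀ e ∉ H, f e = 0) (hfH : ∀ e ∈ H, 0 < ((σ e : ℤ) : ℝ) * f e) :
    o.orientedSubgraphFace H σ = o.supportFace f := by
  ext x
  refine and_congr_right fun hx => ⟨fun h => ?_, fun h C c hc hCH hcσ => ⟨hx, ?_⟩⟩
  · have : inner ℝ x f = (∑ e, signAt f e * f e) / 2 := by
      refine Submodule.span_induction (R := NNReal)
        (p := fun g _ => inner ℝ x g = (∑ e, signAt f e * g e) / 2) ?_ (by simp) ?_ ?_
        (mem_span_conformalCircuits hf)
      · rintro c ⟨C, hc, hpos⟩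
        rw [Finset.sum_congr rfl fun e _ => hc.signAt_mul hpos e, ← hc.inner_self]
        refine (h C c hc (fun e he => ?_) fun e he => ?_).2
        · by_contra heH
          have := hpos e he
          simp [hf0 e heH] at this
        · have h1 := hpos e he
          have heH : e ∈ H := by
            by_contra heH
            simp [hf0 e heH] at h1
          have h2 := hfH e heH
          rcases hc.eq_one_or_neg_one he with h3 | h3 <;>
          rcases Int.units_eq_one_or (σ e) with h4 | h4 <;> simp [h3, h4] at h1 h2 ⊢ <;> linarith
      · intro a b _ _ ha hb
        simp only [inner_add_right, PiLp.add_apply, mul_add, Finset.sum_add_distrib]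
        linarith
      · intro r a _ ha
        have h1 : inner ℝ x (r • a) = (r : ℝ) * inner ℝ x a := inner_smul_right _ _ (r : ℝ)
        have h2 : ∑ e, signAt f e * (r • a) e = r * ∑ e, signAt f e * a e := by
          rw [Finset.mul_sum]
          refine Finset.sum_congr rfl fun e _ => ?_
          have : (r • a) e = (r : ℝ) * a e := rfl
          rw [this]; ring
        rw [h1, h2, mul_div_assoc, ha]
    simpa only [signAt_mul_self] using this
  · have hpos : ∀ e ∈ C, 0 < c e * f e := fun e he => by rw [hcσ e he]; exact hfH e (hCH he)
    rw [inner_eq_of_mem_supportFace (⟨hx, h⟩ : x ∈ o.supportFace f) hf hc.mem_realFlows,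
      hc.inner_self, Finset.sum_congr rfl fun e _ => hc.signAt_mul hpos e]
    intro e he
    refine hc.eq_zero fun heC => ?_
    have := hpos e heC
    simp [he] at this

/-- The faces attached to the strong orientations of a spanning subgraph. -/
theorem setOf_orientedSubgraphFace_eq (o : G.EdgeOrientation) (H : Set E(G)) :
    {F | ∃ σ : E(G) → ℤˣ, o.IsStrongOn H σ ∧ F = o.orientedSubgraphFace H σ} =
      {F | ∃ f ∈ o.realFlows, (∀ e, f e ≠ 0 ↔ e ∈ H) ∧ F = o.supportFace f} := by
  ext F
  constructor
  · rintro ⟨σ, hσ, rfl⟩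
    obtain ⟨f, hf, hf0, hfH⟩ := hσ.exists_flow
    refine ⟨f, hf, fun e => ⟨fun h => by_contra fun he => h (hf0 e he), fun he h => ?_⟩,
      orientedSubgraphFace_eq_supportFace hf hf0 hfH⟩
    have := hfH e he
    simp [h] at this
  · rintro ⟨f, hf, hfH, rfl⟩
    have hf0 (e) (he : e ∉ H) : f e = 0 := not_not.1 fun h => he ((hfH e).1 h)
    let σ : E(G) → ℤˣ := fun e => if 0 < f e then 1 else -1
    have hσ (e) (he : e ∈ H) : 0 < ((σ e : ℤ) : ℝ) * f e := by
      by_cases h : 0 < f e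
      · simp [σ, h]
      · have : f e < 0 := lt_of_le_of_ne (not_lt.1 h) ((hfH e).2 he)
        simp [σ, h, this]
    exact ⟨σ, isStrongOn_of_flow hf hf0 hσ, (orientedSubgraphFace_eq_supportFace hf hf0 hσ).symm⟩

/-! ### Edges of the Voronoi cell -/

/-- In a 3-edge-connected graph, any edge carries a flow that vanishes on another given edge. -/
theorem exists_flow_of_isThreeEdgeConnected (o : G.EdgeOrientation)
    (hG : G.IsThreeEdgeConnected) (e e' : E(G)) :
    ∃ g ∈ o.realFlows, g e' ≠ 0 ∧ (e' ≠ e → g e = 0) := by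
  classical
  have hS : ({(e : β), (e' : β)} : Set β).encard ≤ 2 := by
    refine (Set.encard_insert_le _ _).trans ?_
    rw [Set.encard_singleton, one_add_one_eq_two]
  -- A path from the head of `e'` to its tail survives the deletion of `e` and `e'`; closing it with
  -- `e'` gives `g`.
  have hconn := (hG _ hS).2
    (o.head e') (by simpa using (o.isLink e').right_mem)
    (o.tail e') (by simpa using (o.isLink e').left_mem)
  let Q : AddSubmonoid (EuclideanSpace ℝ E(G)) :=
    { carrier := {p | p e = 0 ∧ p e' = 0}
      zero_mem' := by simp
      add_mem' := fun {a b} ha hb => ⟨by simp [ha.1, hb.1], by simp [ha.2, hb.2]⟩ }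
  obtain ⟨p, hp, hp'⟩ := exists_isUnitFlow_of_reflTransGen (o := o) Q (fun a b hab => by
    obtain ⟨x, hx⟩ := hab
    rw [deleteEdges_isLink] at hx
    obtain ⟨hx, hxS⟩ := hx
    simp only [Set.mem_insert_iff, Set.mem_singleton_iff, not_or] at hxS
    let y : E(G) := ⟨x, hx.edge_mem⟩
    have h1 : e ≠ y := fun h => hxS.1 (congrArg Subtype.val h).symm
    have h2 : e' ≠ y := fun h => hxS.2 (congrArg Subtype.val h).symm
    rcases (o.isLink y).eq_and_eq_or_eq_and_eq hx with h3 | h3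
    · exact ⟨_, ⟨by simp [h1], by simp [h2]⟩, h3.1 ▸ h3.2 ▸ isUnitFlow_single o y⟩
    · exact ⟨_, ⟨by simp [h1], by simp [h2]⟩, h3.1 ▸ h3.2 ▸ isUnitFlow_single_neg o y⟩) hconn
  refine ⟨_, (hp'.add (isUnitFlow_single o e')).mem_realFlows, ?_, fun h => ?_⟩
  · simp [hp.2]
  · simp [hp.1, h.symm]

theorem exists_flow_ne_zero_iff (o : G.EdgeOrientation) (hG : G.IsThreeEdgeConnected)
    (e : E(G)) : ∃ f ∈ o.realFlows, ∀ a, f a ≠ 0 ↔ a ≠ e := by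
  classical
  suffices hs : ∀ s : Finset E(G), e ∉ s → ∃ f ∈ o.realFlows, f e = 0 ∧ ∀ a ∈ s, f a ≠ 0 by
    obtain ⟨f, hf, h0, h1⟩ := hs (Finset.univ.erase e) (by simp)
    exact ⟨f, hf, fun a => ⟨fun ha hae => ha (hae ▸ h0), fun h => h1 a (by simpa using h)⟩⟩
  intro s
  induction s using Finset.induction_on with
  | empty => exact fun _ => ⟨0, zero_mem _, by simp⟩
  | insert b s hb ih =>
    intro he
    simp only [Finset.mem_insert, not_or] at he
    obtain ⟨f, hf, h0, h1⟩ := ih he.2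
    obtain ⟨g, hg, hgb, hge⟩ := o.exists_flow_of_isThreeEdgeConnected hG e b
    -- A generic `t`: only finitely many values cancel a coordinate where `g` is nonzero.
    obtain ⟨t, ht⟩ := Infinite.exists_notMem_finset (Finset.univ.image fun a => -f a / g a)
    refine ⟨f + t • g, add_mem hf (Submodule.smul_mem _ _ hg), by simp [h0, hge (Ne.symm he.1)],
      fun a ha => ?_⟩
    by_cases hga : g a = 0
    · have : a ∈ s := (Finset.mem_insert.1 ha).resolve_left (by rintro rfl; exact hgb hga)
      simpa [hga] using h1 a this
    · intro h
      refine ht (Finset.mem_image.2 ⟨a, Finset.mem_univ _, ?_⟩)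
      simp only [PiLp.add_apply, PiLp.smul_apply, smul_eq_mul] at h
      rw [div_eq_iff hga]
      linarith

theorem edgeProj_ne_zero (o : G.EdgeOrientation) (hG : G.IsThreeEdgeConnected) (e : E(G)) :
    o.edgeProj e ≠ 0 := by
  intro h
  obtain ⟨g, hg, hge, -⟩ := o.exists_flow_of_isThreeEdgeConnected hG e e
  rw [← inner_edgeProj hg, h, inner_zero_left] at hge
  exact hge rfl

theorem edgeProj_notMem_span (o : G.EdgeOrientation) (hG : G.IsThreeEdgeConnected)
    {e e' : E(G)} (h : e' ≠ e) : o.edgeProj e' ∉ Submodule.span ℝ {o.edgeProj e} := by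
  intro hmem
  obtain ⟨r, hr⟩ := Submodule.mem_span_singleton.1 hmem
  obtain ⟨g, hg, hge, h0⟩ := o.exists_flow_of_isThreeEdgeConnected hG e e'
  apply hge
  rw [← inner_edgeProj hg, ← hr, real_inner_smul_left, inner_edgeProj hg, h0 h, mul_zero]

/-- A flow vanishes at `e` exactly when it is orthogonal to `edgeProj e`. -/
theorem vectorSpan_supportFace_of_ne_zero_iff {o : G.EdgeOrientation}
    {f : EuclideanSpace ℝ E(G)} (hf : f ∈ o.realFlows) {e : E(G)} (h : ∀ a, f a ≠ 0 ↔ a ≠ e) :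
    vectorSpan ℝ (o.supportFace f) = Submodule.span ℝ {o.edgeProj e} := by
  have hle : Submodule.span ℝ {o.edgeProj e} ≤ o.realFlows := by
    rw [Submodule.span_singleton_le_iff_mem]
    exact o.edgeProj_mem e
  have : o.flowsUnder f = (Submodule.span ℝ {o.edgeProj e})ᗮ ⊓ o.realFlows := by
    ext g
    rw [mem_flowsUnder, Submodule.mem_inf, and_comm]
    refine and_congr_left fun hg => ?_
    rw [Submodule.mem_orthogonal_singleton_iff_inner_right, inner_edgeProj hg]
    have h' (a) : f a = 0 ↔ a = e := not_iff_not.1 (h a)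
    simp [h']
  rw [vectorSpan_supportFace hf, this, orthogonal_inf_orthogonal_inf hle]

theorem mem_polytopeEdges_iff {o : G.EdgeOrientation} (hG : G.IsThreeEdgeConnected)
    {F : Set (EuclideanSpace ℝ E(G))} :
    F ∈ polytopeEdges o.flowVoronoiCell ↔
      ∃ e, ∃ f ∈ o.realFlows, (∀ a, f a ≠ 0 ↔ a ≠ e) ∧ F = o.supportFace f := by
  simp only [polytopeEdges, Set.mem_ofPred_eq, isFaceOfPolytope_iff]
  constructor
  · rintro ⟨⟨f, hf, rfl⟩, hdim⟩
    -- With full support the face would be a point; two zeros of `f` would give two independent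
    -- directions.
    obtain ⟨e, he⟩ : ∃ e, f e = 0 := by
      by_contra! hne
      have h1 : o.flowsUnder f = o.realFlows :=
        le_antisymm (o.flowsUnder_le f) fun g hg => ⟨hg, fun e he => absurd he (hne e)⟩
      have := finrank_flowsUnder_add_affDim hf
      rw [h1] at this
      omega
    refine ⟨e, f, hf, fun a => ⟨fun h => by rintro rfl; exact h he, fun hae ha => ?_⟩, rfl⟩
    refine o.edgeProj_notMem_span hG hae (Submodule.mem_span_singleton.2 ?_)
    obtain ⟨r, hr⟩ := exists_smul_eq_of_finrank_eq_one hdim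
      (x := (⟨_, edgeProj_mem_vectorSpan hf he⟩ : vectorSpan ℝ (o.supportFace f)))
      (by simpa using o.edgeProj_ne_zero hG e) ⟨_, edgeProj_mem_vectorSpan hf ha⟩
    exact ⟨r, congrArg Subtype.val hr⟩
  · rintro ⟨e, f, hf, h, rfl⟩
    refine ⟨⟨f, hf, rfl⟩, ?_⟩
    rw [affDim, vectorSpan_supportFace_of_ne_zero_iff hf h,
      finrank_span_singleton (o.edgeProj_ne_zero hG e)]

/-! ### Parallel classes and incidence -/

/-- The edges of the Voronoi cell given by the strong orientations of `G - e`. -/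
def edgeClass (o : G.EdgeOrientation) (e : E(G)) : Set (Set (EuclideanSpace ℝ E(G))) :=
  {ε | ∃ σ : E(G) → ℤˣ, o.IsStrongOn {e}ᶜ σ ∧ ε = o.orientedSubgraphFace {e}ᶜ σ}

theorem mem_edgeClass {o : G.EdgeOrientation} {e : E(G)} {F : Set (EuclideanSpace ℝ E(G))} :
    F ∈ o.edgeClass e ↔
      ∃ f ∈ o.realFlows, (∀ a, f a ≠ 0 ↔ a ≠ e) ∧ F = o.supportFace f := by
  rw [edgeClass, setOf_orientedSubgraphFace_eq]
  rfl

/-- The facets of the Voronoi cell given by the two orientations of a circuit. -/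
def facetClass (o : G.EdgeOrientation) (C : Set E(G)) : Set (Set (EuclideanSpace ℝ E(G))) :=
  {F | ∃ c, o.IsCircuitElement C c ∧ F = o.bisectorFace c}

theorem parallel_edges_eq_edgeClass {o : G.EdgeOrientation} (hG : G.IsThreeEdgeConnected)
    {e : E(G)} {f : EuclideanSpace ℝ E(G)} (hf : f ∈ o.realFlows)
    (h : ∀ a, f a ≠ 0 ↔ a ≠ e) :
    {F ∈ polytopeEdges o.flowVoronoiCell |
      vectorSpan ℝ F = vectorSpan ℝ (o.supportFace f)} = o.edgeClass e := by
  ext F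
  rw [Set.mem_ofPred_eq, mem_polytopeEdges_iff hG, mem_edgeClass,
    vectorSpan_supportFace_of_ne_zero_iff hf h]
  constructor
  · rintro ⟨⟨e', f', hf', h', rfl⟩, hdir⟩
    rw [vectorSpan_supportFace_of_ne_zero_iff hf' h'] at hdir
    obtain rfl : e' = e := by
      by_contra hne
      exact o.edgeProj_notMem_span hG hne (hdir ▸ Submodule.mem_span_singleton_self _)
    exact ⟨f', hf', h', rfl⟩
  · rintro ⟨f', hf', h', rfl⟩
    exact ⟨⟨e, f', hf', h', rfl⟩, vectorSpan_supportFace_of_ne_zero_iff hf' h'⟩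

theorem parallel_facets_eq_facetClass {o : G.EdgeOrientation} {C : Set E(G)}
    {c : EuclideanSpace ℝ E(G)} (hc : o.IsCircuitElement C c) :
    {F ∈ polytopeFacets o.flowVoronoiCell |
      vectorSpan ℝ F = vectorSpan ℝ (o.supportFace c)} = o.facetClass C := by
  ext F
  rw [Set.mem_ofPred_eq, mem_polytopeFacets_iff]
  constructor
  · rintro ⟨⟨C', c', hc', rfl⟩, hdir⟩
    obtain rfl := (vectorSpan_supportFace_circuit_eq_iff hc' hc).1 hdir
    exact ⟨c', hc', hc'.supportFace_eq⟩
  · rintro ⟨c', hc', rfl⟩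
    rw [← hc'.supportFace_eq]
    exact ⟨⟨C, c', hc', rfl⟩, (vectorSpan_supportFace_circuit_eq_iff hc' hc).2 rfl⟩

theorem edgeClass_mem_parallelClasses (o : G.EdgeOrientation) (hG : G.IsThreeEdgeConnected)
    (e : E(G)) : o.edgeClass e ∈ parallelClasses (polytopeEdges o.flowVoronoiCell) := by
  obtain ⟨f, hf, h⟩ := o.exists_flow_ne_zero_iff hG e
  exact ⟨_, (mem_polytopeEdges_iff hG).2 ⟨e, f, hf, h, rfl⟩,
    (parallel_edges_eq_edgeClass hG hf h).symm⟩

theorem facetClass_mem_parallelClasses (o : G.EdgeOrientation) {C : Set E(G)}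
    (hC : G.IsCircuit C) :
    o.facetClass C ∈ parallelClasses (polytopeFacets o.flowVoronoiCell) := by
  obtain ⟨c, hc⟩ := o.exists_isCircuitElement hC
  exact ⟨_, mem_polytopeFacets_iff.2 ⟨C, c, hc, rfl⟩, (parallel_facets_eq_facetClass hc).symm⟩

theorem bijective_edgeClass (o : G.EdgeOrientation) (hG : G.IsThreeEdgeConnected) :
    Function.Bijective fun e => (⟨o.edgeClass e, o.edgeClass_mem_parallelClasses hG e⟩ :
      parallelClasses (polytopeEdges o.flowVoronoiCell)) := by
  constructor
  · intro e e' hee'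
    have hee' : o.edgeClass e = o.edgeClass e' := congrArg Subtype.val hee'
    obtain ⟨f, hf, h⟩ := o.exists_flow_ne_zero_iff hG e
    have hmem : o.supportFace f ∈ o.edgeClass e := mem_edgeClass.2 ⟨f, hf, h, rfl⟩
    rw [hee', mem_edgeClass] at hmem
    obtain ⟨f', hf', h', heq⟩ := hmem
    by_contra hne
    refine o.edgeProj_notMem_span hG hne ?_
    rw [← vectorSpan_supportFace_of_ne_zero_iff hf' h', ← heq,
      vectorSpan_supportFace_of_ne_zero_iff hf h]
    exact Submodule.mem_span_singleton_self _
  · rintro ⟨_, F, hF, rfl⟩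
    obtain ⟨e, f, hf, h, rfl⟩ := (mem_polytopeEdges_iff hG).1 hF
    exact ⟨e, Subtype.ext (parallel_edges_eq_edgeClass hG hf h).symm⟩

theorem bijective_facetClass (o : G.EdgeOrientation) :
    Function.Bijective fun C : {C : Set E(G) // G.IsCircuit C} =>
      (⟨o.facetClass C.1, o.facetClass_mem_parallelClasses C.2⟩ :
        parallelClasses (polytopeFacets o.flowVoronoiCell)) := by
  constructor
  · rintro ⟨C, hC⟩ ⟨C', hC'⟩ hCC'
    have hCC' : o.facetClass C = o.facetClass C' := congrArg Subtype.val hCC'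
    obtain ⟨c, hc⟩ := o.exists_isCircuitElement hC
    have hmem : o.bisectorFace c ∈ o.facetClass C := ⟨c, hc, rfl⟩
    rw [hCC'] at hmem
    obtain ⟨c', hc', heq⟩ := hmem
    refine Subtype.ext ((vectorSpan_supportFace_circuit_eq_iff hc hc').1 ?_)
    rw [hc.supportFace_eq, hc'.supportFace_eq, heq]
  · rintro ⟨_, F, hF, rfl⟩
    obtain ⟨C, c, hc, rfl⟩ := mem_polytopeFacets_iff.1 hF
    exact ⟨⟨C, hc.isCircuit⟩, Subtype.ext (parallel_facets_eq_facetClass hc).symm⟩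

/-- Containment would make the edge direction `edgeProj e` orthogonal to `c`, but their product is
`c e`. If `e ∉ C`, the signs of a flow on `G - e` can be adjusted to follow `c` on `C`. -/
theorem mem_circuit_iff_forall_edgeClass {o : G.EdgeOrientation} (hG : G.IsThreeEdgeConnected)
    (e : E(G)) {C : Set E(G)} {c : EuclideanSpace ℝ E(G)} (hc : o.IsCircuitElement C c) :
    e ∈ C ↔ ∀ ε ∈ o.edgeClass e, ¬ ε ⊆ o.bisectorFace c := by
  rw [← hc.supportFace_eq]
  constructor
  · intro he ε hε hsub
    obtain ⟨f, hf, h, rfl⟩ := mem_edgeClass.1 hε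
    have h1 := vectorSpan_mono ℝ hsub
    have h2 : f e = 0 := not_not.1 fun h' => (h e).1 h' rfl
    have h3 := h1 (edgeProj_mem_vectorSpan hf h2)
    rw [vectorSpan_supportFace hc.mem_realFlows] at h3
    have h4 := (Submodule.mem_orthogonal' _ _).1 h3.1 c ⟨hc.mem_realFlows, fun _ h => h⟩
    rw [inner_edgeProj hc.mem_realFlows] at h4
    exact hc.ne_zero_iff.2 he h4
  · intro hne
    by_contra he
    obtain ⟨f, hf, h⟩ := o.exists_flow_ne_zero_iff hG e
    -- `N` exceeds every `|f a|`, so `f + N • c` has the signs of `c` on `C` and equals `f`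
    -- elsewhere.
    set N : ℝ := 1 + ∑ a, |f a| with hN
    have hlt (a : E(G)) : |f a| < N := by
      have := Finset.single_le_sum (f := fun a => |f a|) (fun _ _ => abs_nonneg _)
        (Finset.mem_univ a)
      simp only at this
      linarith
    have hpos (a : E(G)) (ha : a ∈ C) : 0 < c a * (f + N • c) a := by
      have := abs_lt.1 (hlt a)
      simp only [PiLp.add_apply, PiLp.smul_apply, smul_eq_mul]
      rcases hc.eq_one_or_neg_one ha with h1 | h1 <;> rw [h1] <;> linarith
    have hfN : f + N • c ∈ o.realFlows := add_mem hf (Submodule.smul_mem _ _ hc.mem_realFlows)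
    refine hne _ (mem_edgeClass.2 ⟨f + N • c, hfN, fun a => ?_, rfl⟩) fun x hx => ⟨hx.1, ?_⟩
    · by_cases ha : a ∈ C
      · refine iff_of_true (fun h0 => ?_) (by rintro rfl; exact he ha)
        have := hpos a ha
        simp [h0] at this
      · simpa [hc.eq_zero ha] using h a
    · rw [inner_eq_of_mem_supportFace hx hfN hc.mem_realFlows,
        Finset.sum_congr rfl fun a _ => hc.signAt_mul hpos a]
      intro a ha0
      refine hc.eq_zero fun ha => ?_
      have := hpos a ha
      simp [ha0] at this

end Graph.EdgeOrientation

theorem theorem3 {α β : Type*} (G : Graph α β) [Fintype E(G)] (o : G.EdgeOrientation)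
    (hG : G.IsThreeEdgeConnected) :
    ∃ (Φ : E(G) ≃ parallelClasses (polytopeEdges o.flowVoronoiCell))
      (Ψ : {C : Set E(G) // G.IsCircuit C} ≃ parallelClasses (polytopeFacets o.flowVoronoiCell)),
      (∀ e : E(G), (Φ e : Set (Set (EuclideanSpace ℝ E(G)))) =
        {ε | ∃ σ : E(G) → ℤˣ, o.IsStrongOn {e}ᶜ σ ∧ ε = o.orientedSubgraphFace {e}ᶜ σ}) ∧
      (∀ C : {C : Set E(G) // G.IsCircuit C}, (Ψ C : Set (Set (EuclideanSpace ℝ E(G)))) =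
        {F | ∃ c, o.IsCircuitElement C c ∧ F = o.bisectorFace c}) ∧
      (∀ (e : E(G)) (C : {C : Set E(G) // G.IsCircuit C}) (c : EuclideanSpace ℝ E(G)),
        o.IsCircuitElement C c →
          (e ∈ C.1 ↔ ∀ ε ∈ (Φ e : Set (Set (EuclideanSpace ℝ E(G)))),
            ¬ ε ⊆ o.bisectorFace c)) :=
  ⟨Equiv.ofBijective _ (o.bijective_edgeClass hG), Equiv.ofBijective _ o.bijective_facetClass,
    fun _ => rfl, fun _ => rfl, fun e _ _ hc =>
      Graph.EdgeOrientation.mem_circuit_iff_forall_edgeClass hG e hc⟩
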